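/- Let $n\ge 1$ be an integer and $\sigma>0$. Let $H=H_{\sigma,1,\mathbb{C}^n}$ be the Hilbert space of all holomorphic functions $f:\mathbb{C}^n\to\mathbb{C}$ with $$\|f\|^2=\frac{1}{(2\pi\sigma^2)^n}\int_{\mathbb{C}^n}|f(z)|^2e^{-\|z\|_2/\sigma}\,dV(z)<\infty,$$ where $\|z\|_2=(|z_1|^2+\dots+|z_n|^2)^{1/2}$ and $V$ is Lebesgue measure on $\mathbb{C}^n$, with the corresponding inner product. Point evaluations are bounded on $H$; let $K_z\in H$ denote the reproducing kernel at $z$, that is $f(z)=\langle f,K_z\rangle$ for all $f\in H$. For a map $\varphi:\mathbb{C}^n\to\mathbb{C}^n$ let $\mathcal K_\varphi f=f\circ\varphi$ be the Koopman operator with domain $\mathcal D(\mathcal K_\varphi)=\{f\in H: f\circ\varphi\in H\}$; it is called bounded over $H$ if $\mathcal D(\mathcal K_\varphi)=H$ and $\mathcal K_\varphi:H\to H$ is a bounded operator, and in that case put $$\Pi_z(\varphi;\sigma)=\frac{\|\mathcal K_\varphi^*K_z\|^2}{\|K_z\|^2}\quad(z\in\mathbb{C}^n),\qquad \|\mathcal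 K_\varphi\|_{\mathrm{ess}}=\inf\{\|\mathcal K_\varphi-T\|:\ T:H\to H\text{ compact}\}.$$ **Theorem.** Let $\varphi(z)=\mathcal A z+B$, where $\mathcal A\in\mathbb{C}^{n\times n}$ is invertible with operator norm $\|\mathcal A\|_2<1$ and $B\in\mathbb{C}^n$. If $\mathcal K_\varphi$ is bounded over $H$, then the limit $\lim_{\|z\|_2\to\infty}\sqrt{\Pi_z(\varphi;\sigma)}$ exists and $$\lim_{\|z\|_2\to\infty}\sqrt{\Pi_z(\varphi;\sigma)}\ \le\ \|\mathcal K_\varphi\|_{\mathrm{ess}}\ \le\ |\det\mathcal A^{-1}|^{n/2}\lim_{\|z\|_2\to\infty}\sqrt{\Pi_z(\varphi;\sigma)} .$$ -/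

import Mathlib

open MeasureTheory Filter Topology
open scoped ENNReal ComplexConjugate

noncomputable section

/-- The measure `(2πσ²)⁻ⁿ exp(-‖z‖₂ / σ) dV(z)` on `ℂⁿ`, where `V` is Lebesgue measure. -/
def laplaceMeasure (σ : ℝ) (n : ℕ) : Measure (EuclideanSpace ℂ (Fin n)) :=
  volume.withDensity fun z =>
    ENNReal.ofReal (((2 * Real.pi * σ ^ 2) ^ n)⁻¹ * Real.exp (-(‖z‖ / σ)))

/-- The entire functions `f : ℂⁿ → ℂ` that are square integrable for `laplaceMeasure σ n`,
as a linear subspace of the space of all functions. -/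
def laplaceSubmodule (σ : ℝ) (n : ℕ) : Submodule ℂ (EuclideanSpace ℂ (Fin n) → ℂ) where
  carrier := {f | Differentiable ℂ f ∧ MemLp f 2 (laplaceMeasure σ n)}
  add_mem' hf hg := ⟨hf.1.add hg.1, hf.2.add hg.2⟩
  zero_mem' := ⟨differentiable_const 0, MemLp.zero⟩
  smul_mem' c _ hf := ⟨hf.1.const_smul c, hf.2.const_smul c⟩

/-- The Hilbert space of the entire functions that are square integrable for `laplaceMeasure σ n`.
It carries the norm topology, not the topology of pointwise convergence. -/
def LaplaceSpace (σ : ℝ) (n : ℕ) : Type := laplaceSubmodule σ n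

namespace LaplaceSpace

instance (σ : ℝ) (n : ℕ) : AddCommGroup (LaplaceSpace σ n) :=
  inferInstanceAs (AddCommGroup (laplaceSubmodule σ n))

instance (σ : ℝ) (n : ℕ) : Module ℂ (LaplaceSpace σ n) :=
  inferInstanceAs (Module ℂ (laplaceSubmodule σ n))

/-- An element of the space, as a function on `ℂⁿ`. -/
def toFun (σ : ℝ) (n : ℕ) : LaplaceSpace σ n →ₗ[ℂ] EuclideanSpace ℂ (Fin n) → ℂ :=
  (laplaceSubmodule σ n).subtype

theorem toFun_injective (σ : ℝ) (n : ℕ) : Function.Injective (toFun σ n) :=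
  Subtype.val_injective

theorem differentiable {σ : ℝ} {n : ℕ} (f : LaplaceSpace σ n) : Differentiable ℂ (toFun σ n f) :=
  f.2.1

theorem memLp {σ : ℝ} {n : ℕ} (f : LaplaceSpace σ n) :
    MemLp (toFun σ n f) 2 (laplaceMeasure σ n) :=
  f.2.2

theorem measurable_density (σ : ℝ) (n : ℕ) :
    Measurable fun z : EuclideanSpace ℂ (Fin n) =>
      ENNReal.ofReal (((2 * Real.pi * σ ^ 2) ^ n)⁻¹ * Real.exp (-(‖z‖ / σ))) := by
  fun_prop

theorem integrable_mul_conj {σ : ℝ} {n : ℕ} (f g : LaplaceSpace σ n) :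
    Integrable (fun z => toFun σ n g z * conj (toFun σ n f z)) (laplaceMeasure σ n) :=
  (memLp g).integrable_mul (memLp f).star

theorem density_pos {σ : ℝ} (hσ : 0 < σ) {n : ℕ} (z : EuclideanSpace ℂ (Fin n)) :
    0 < ((2 * Real.pi * σ ^ 2) ^ n)⁻¹ * Real.exp (-(‖z‖ / σ)) := by
  positivity

theorem volume_ac (σ : ℝ) [hσ : Fact (0 < σ)] (n : ℕ) :
    (volume : Measure (EuclideanSpace ℂ (Fin n))) ≪ laplaceMeasure σ n := by
  refine withDensity_absolutelyContinuous' (measurable_density σ n).aemeasurable ?_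
  refine Eventually.of_forall fun z => ?_
  simpa using density_pos hσ.out z

/-- The inner product `(2πσ²)⁻ⁿ ∫ g(z) conj(f(z)) exp(-‖z‖₂ / σ) dV(z)` (Mathlib's inner products
are conjugate-linear in the first argument `f`). -/
abbrev core (σ : ℝ) [Fact (0 < σ)] (n : ℕ) : InnerProductSpace.Core ℂ (LaplaceSpace σ n) where
  inner f g := ∫ z, toFun σ n g z * conj (toFun σ n f z) ∂(laplaceMeasure σ n)
  conj_inner_symm f g := by
    rw [← integral_conj]
    simp [mul_comm]
  re_inner_nonneg f := by
    simp only [Complex.mul_conj, integral_complex_ofReal]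
    exact integral_nonneg fun z => Complex.normSq_nonneg _
  add_left f g h := by
    simp only [map_add, Pi.add_apply, mul_add]
    exact integral_add (integrable_mul_conj f h) (integrable_mul_conj g h)
  smul_left f g c := by
    simp only [map_smul, Pi.smul_apply, smul_eq_mul, map_mul]
    rw [← integral_const_mul]
    congr 1
    ext z
    ring
  definite f hf := by
    have h0 : (fun z => Complex.normSq (toFun σ n f z)) =ᵐ[laplaceMeasure σ n] 0 := by
      rw [← integral_eq_zero_iff_of_nonneg (fun z => Complex.normSq_nonneg _)]
      · simp only [Complex.mul_conj, integral_complex_ofReal] at hf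
        exact_mod_cast hf
      · have := (integrable_mul_conj f f).re
        simpa [Complex.mul_conj] using this
    have h1 := (volume_ac σ n).ae_eq h0
    have h2 := (Complex.continuous_normSq.comp (differentiable f).continuous).ae_eq_iff_eq volume
      continuous_const |>.1 h1
    apply toFun_injective σ n
    ext z
    exact Complex.normSq_eq_zero.1 (congrFun h2 z)

instance (σ : ℝ) [Fact (0 < σ)] (n : ℕ) : NormedAddCommGroup (LaplaceSpace σ n) :=
  (core σ n).toNormedAddCommGroup

instance (σ : ℝ) [Fact (0 < σ)] (n : ℕ) : InnerProductSpace ℂ (LaplaceSpace σ n) :=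
  InnerProductSpace.ofCore (core σ n).toCore

theorem inner_def {σ : ℝ} [Fact (0 < σ)] {n : ℕ} (f g : LaplaceSpace σ n) :
    inner ℂ f g = ∫ z, toFun σ n g z * conj (toFun σ n f z) ∂(laplaceMeasure σ n) :=
  rfl

theorem norm_sq {σ : ℝ} [Fact (0 < σ)] {n : ℕ} (f : LaplaceSpace σ n) :
    ‖f‖ ^ 2 = ∫ z, ‖toFun σ n f z‖ ^ 2 ∂(laplaceMeasure σ n) := by
  have h := inner_self_eq_norm_sq_to_K (𝕜 := ℂ) f
  rw [inner_def] at h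
  simp only [Complex.mul_conj, integral_complex_ofReal, Complex.normSq_eq_norm_sq] at h
  exact (Complex.ofReal_injective (by simpa using h)).symm

theorem enorm_eq {σ : ℝ} [Fact (0 < σ)] {n : ℕ} (f : LaplaceSpace σ n) :
    ‖f‖ₑ = eLpNorm (toFun σ n f) 2 (laplaceMeasure σ n) := by
  have h : ‖f‖ = (eLpNorm (toFun σ n f) 2 (laplaceMeasure σ n)).toReal := by
    rw [(memLp f).eLpNorm_eq_integral_rpow_norm (by norm_num) (by norm_num),
      ENNReal.toReal_ofReal (by positivity)]
    simp only [ENNReal.toReal_ofNat, Real.rpow_ofNat]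
    rw [← norm_sq, ← one_div, ← Real.sqrt_eq_rpow, Real.sqrt_sq (norm_nonneg _)]
  rw [← ofReal_norm, h, ENNReal.ofReal_toReal (memLp f).2.ne]

theorem lintegral_sq {σ : ℝ} [Fact (0 < σ)] {n : ℕ} (f : LaplaceSpace σ n) :
    ∫⁻ z, ‖toFun σ n f z‖ₑ ^ 2 ∂(laplaceMeasure σ n) = ‖f‖ₑ ^ 2 := by
  rw [enorm_eq, eLpNorm_eq_lintegral_rpow_enorm_toReal (by norm_num) (by norm_num)]
  simp only [ENNReal.toReal_ofNat, ENNReal.rpow_ofNat]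
  rw [← ENNReal.rpow_natCast, ← ENNReal.rpow_mul]
  norm_num

/-- Sub-mean value inequality over a circle. -/
theorem circle_mean {n : ℕ} {f : EuclideanSpace ℂ (Fin n) → ℂ} (hf : Differentiable ℂ f)
    (z w : EuclideanSpace ℂ (Fin n)) :
    ENNReal.ofReal (2 * Real.pi) * ‖f z‖ₑ ≤
      ∫⁻ θ in Set.Ioc 0 (2 * Real.pi), ‖f (z + circleMap 0 1 θ • w)‖ₑ := by
  have hg : Differentiable ℂ fun c : ℂ => f (z + c • w) := by fun_prop
  have h := (hg.diffContOnCl (s := Metric.ball 0 |1|)).circleAverage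
  simp only [Real.circleAverage, zero_smul, add_zero] at h
  have hpi : (0 : ℝ) < 2 * Real.pi := by positivity
  rw [inv_smul_eq_iff₀ hpi.ne', intervalIntegral.integral_of_le hpi.le] at h
  calc ENNReal.ofReal (2 * Real.pi) * ‖f z‖ₑ = ‖(2 * Real.pi) • f z‖ₑ := by
        rw [enorm_smul, Real.enorm_of_nonneg hpi.le]
    _ ≤ _ := by
        rw [← h]
        exact enorm_integral_le_lintegral_enorm _

/-- Sub-mean value inequality over a ball. -/
theorem ball_mean {n : ℕ} {f : EuclideanSpace ℂ (Fin n) → ℂ} (hf : Differentiable ℂ f)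
    (z : EuclideanSpace ℂ (Fin n)) :
    ‖f z‖ₑ * volume (Metric.ball (0 : EuclideanSpace ℂ (Fin n)) 1) ≤
      ∫⁻ w in Metric.ball z 1, ‖f w‖ₑ := by
  have hrot (θ : ℝ) : ∫⁻ w in Metric.ball (0 : EuclideanSpace ℂ (Fin n)) 1,
      ‖f (z + circleMap 0 1 θ • w)‖ₑ = ∫⁻ w in Metric.ball z 1, ‖f w‖ₑ := by
    have hc : ‖circleMap 0 1 θ‖ = 1 := by simp [circleMap]
    have hc0 : circleMap 0 1 θ ≠ 0 := fun h => by simp [h] at hc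
    let r : EuclideanSpace ℂ (Fin n) ≃ₗᵢ[ℝ] EuclideanSpace ℂ (Fin n) :=
      { (LinearEquiv.smulOfNeZero ℂ (EuclideanSpace ℂ (Fin n)) _ hc0).restrictScalars ℝ with
        norm_map' := fun w => by
          change ‖circleMap 0 1 θ • w‖ = ‖w‖
          rw [norm_smul, hc, one_mul] }
    have hr (w) : r w = circleMap 0 1 θ • w := rfl
    have hmp : MeasurePreserving (fun w => z + r w) volume volume :=
      (measurePreserving_add_left volume z).comp r.measurePreserving
    have hball : (fun w => z + r w) ⁻¹' Metric.ball z 1 = Metric.ball 0 1 := by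
      ext w
      simp
    have hemb : MeasurableEmbedding (fun w => z + r w) :=
      (measurableEmbedding_addLeft z).comp r.toHomeomorph.measurableEmbedding
    have h := hmp.setLIntegral_comp_preimage_emb hemb (fun w => ‖f w‖ₑ) (Metric.ball z 1)
    rw [hball] at h
    exact h
  have hpi : (0 : ℝ) < 2 * Real.pi := by positivity
  have h1 : ∫⁻ w in Metric.ball (0 : EuclideanSpace ℂ (Fin n)) 1,
      ENNReal.ofReal (2 * Real.pi) * ‖f z‖ₑ ≤
      ∫⁻ w in Metric.ball (0 : EuclideanSpace ℂ (Fin n)) 1,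
        ∫⁻ θ in Set.Ioc 0 (2 * Real.pi), ‖f (z + circleMap 0 1 θ • w)‖ₑ :=
    lintegral_mono fun w => circle_mean hf z w
  rw [lintegral_lintegral_swap, setLIntegral_const] at h1
  · simp only [hrot, lintegral_const, Measure.restrict_apply_univ, Real.volume_Ioc, sub_zero] at h1
    rw [mul_assoc, mul_comm (lintegral _ _)] at h1
    exact (ENNReal.mul_le_mul_iff_right (by simpa using hpi)
      ENNReal.ofReal_ne_top).1 h1
  · have hcm : Continuous fun p : EuclideanSpace ℂ (Fin n) × ℝ =>
        f (z + circleMap 0 1 p.2 • p.1) := by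
      have := hf.continuous
      have := continuous_circleMap 0 1
      fun_prop
    exact hcm.enorm.measurable.aemeasurable

/-- Point evaluations are bounded, uniformly on balls. -/
theorem exists_eval_le (σ : ℝ) [hσ : Fact (0 < σ)] (n : ℕ) (R : ℝ) :
    ∃ C : ℝ, 0 < C ∧ ∀ (f : LaplaceSpace σ n) (z : EuclideanSpace ℂ (Fin n)), ‖z‖ ≤ R →
      ‖toFun σ n f z‖ ≤ C * ‖f‖ := by
  have hσ' := hσ.out
  set m : ℝ := ((2 * Real.pi * σ ^ 2) ^ n)⁻¹ * Real.exp (-((R + 1) / σ)) with hm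
  have hm0 : 0 < m := by positivity
  set v : ℝ := (volume (Metric.ball (0 : EuclideanSpace ℂ (Fin n)) 1)).toReal with hv
  have hvtop : volume (Metric.ball (0 : EuclideanSpace ℂ (Fin n)) 1) ≠ ⊤ :=
    measure_ball_lt_top.ne
  have hv0 : 0 < v :=
    ENNReal.toReal_pos (Metric.measure_ball_pos volume _ one_pos).ne' hvtop
  refine ⟨√((m * v)⁻¹), by positivity, fun f z hz => ?_⟩
  have key : ENNReal.ofReal m * (‖toFun σ n f z‖ₑ ^ 2 * ENNReal.ofReal v) ≤ ‖f‖ₑ ^ 2 := by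
    rw [hv, ENNReal.ofReal_toReal hvtop, ← lintegral_sq, laplaceMeasure,
      lintegral_withDensity_eq_lintegral_mul₀ (measurable_density σ n).aemeasurable
        ((differentiable f).continuous.enorm.measurable.pow_const 2).aemeasurable]
    have hb := ball_mean ((differentiable f).pow 2) z
    simp only [Pi.pow_apply, enorm_pow] at hb
    calc _ ≤ ENNReal.ofReal m * ∫⁻ w in Metric.ball z 1, ‖toFun σ n f w‖ₑ ^ 2 := by gcongr
      _ = ∫⁻ w in Metric.ball z 1, ENNReal.ofReal m * ‖toFun σ n f w‖ₑ ^ 2 := by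
        rw [lintegral_const_mul]
        exact ((differentiable f).continuous.enorm.measurable.pow_const 2)
      _ ≤ ∫⁻ w in Metric.ball z 1, ENNReal.ofReal (((2 * Real.pi * σ ^ 2) ^ n)⁻¹ *
            Real.exp (-(‖w‖ / σ))) * ‖toFun σ n f w‖ₑ ^ 2 := by
        refine setLIntegral_mono' measurableSet_ball fun w hw => ?_
        have hw' : ‖w‖ ≤ R + 1 := by
          rw [mem_ball_iff_norm] at hw
          have h2 := norm_sub_norm_le w z
          linarith
        rw [hm]
        gcongr
      _ ≤ _ := setLIntegral_le_lintegral _ _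
  have key' : m * (‖toFun σ n f z‖ ^ 2 * v) ≤ ‖f‖ ^ 2 := by
    rw [← ofReal_norm, ← ofReal_norm, ← ENNReal.ofReal_pow (norm_nonneg _),
      ← ENNReal.ofReal_pow (norm_nonneg _), ← ENNReal.ofReal_mul (by positivity),
      ← ENNReal.ofReal_mul hm0.le] at key
    exact (ENNReal.ofReal_le_ofReal_iff (by positivity)).1 key
  refine le_of_sq_le_sq ?_ (by positivity)
  rw [mul_pow, Real.sq_sqrt (by positivity), inv_mul_eq_div, le_div_iff₀ (by positivity)]
  linarith

/-- A pointwise limit of entire functions that is uniform on balls is entire. -/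
theorem differentiable_of_limit {n : ℕ} {F : ℕ → EuclideanSpace ℂ (Fin n) → ℂ}
    {f : EuclideanSpace ℂ (Fin n) → ℂ} (hF : ∀ k, Differentiable ℂ (F k))
    (hlim : ∀ z, Tendsto (fun k => F k z) atTop (𝓝 (f z)))
    (hunif : ∀ R ε : ℝ, 0 < ε → ∃ N, ∀ j ≥ N, ∀ k ≥ N, ∀ z, ‖z‖ ≤ R → ‖F j z - F k z‖ ≤ ε) :
    Differentiable ℂ f := by
  have hd : ∀ R ε : ℝ, 0 < ε → ∃ N, ∀ j ≥ N, ∀ k ≥ N, ∀ z, ‖z‖ ≤ R →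
      ‖fderiv ℂ (F j) z - fderiv ℂ (F k) z‖ ≤ ε := by
    intro R ε hε
    obtain ⟨N, hN⟩ := hunif (R + 1) (ε / 2) (half_pos hε)
    refine ⟨N, fun j hj k hk z hz => ?_⟩
    rw [← fderiv_sub (hF j z) (hF k z)]
    have := Complex.norm_fderiv_le_div_of_mapsTo_ball (f := F j - F k) (c := z) (R₁ := 1)
      (R₂ := ε) ((hF j).sub (hF k)).differentiableOn (fun w hw => ?_) one_pos
    · simpa using this
    · rw [mem_ball_iff_norm] at hw
      have h2 := norm_sub_norm_le w z
      have h3 := hN j hj k hk w (by linarith)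
      have h4 := hN j hj k hk z (by linarith)
      rw [mem_closedBall_iff_norm]
      refine (norm_sub_le _ _).trans ?_
      simp only [Pi.sub_apply]
      linarith
  have hcau (z : EuclideanSpace ℂ (Fin n)) : CauchySeq fun k => fderiv ℂ (F k) z := by
    rw [Metric.cauchySeq_iff]
    intro ε hε
    obtain ⟨N, hN⟩ := hd ‖z‖ (ε / 2) (half_pos hε)
    refine ⟨N, fun j hj k hk => ?_⟩
    rw [dist_eq_norm]
    linarith [hN j hj k hk z le_rfl]
  choose f' hf' using fun z => cauchySeq_tendsto_of_complete (hcau z)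
  intro x
  have hx : x ∈ Metric.ball (0 : EuclideanSpace ℂ (Fin n)) (‖x‖ + 1) := by simp
  refine (hasFDerivAt_of_tendstoLocallyUniformlyOn (f := F) (f' := fun k => fderiv ℂ (F k))
    (g' := f') (g := f) (l := atTop) Metric.isOpen_ball
    (TendstoUniformlyOn.tendstoLocallyUniformlyOn ?_)
    (fun k z _ => (hF k z).hasFDerivAt) (fun z _ => hlim z) hx).differentiableAt
  rw [Metric.tendstoUniformlyOn_iff]
  intro ε hε
  obtain ⟨N, hN⟩ := hd (‖x‖ + 1) (ε / 2) (half_pos hε)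
  filter_upwards [eventually_ge_atTop N] with k hk z hz
  have hz' : ‖z‖ ≤ ‖x‖ + 1 := by
    rw [mem_ball_zero_iff] at hz
    exact hz.le
  have : ‖f' z - fderiv ℂ (F k) z‖ ≤ ε / 2 :=
    le_of_tendsto ((hf' z).sub_const _).norm
      (eventually_atTop.2 ⟨N, fun j hj => hN j hj k hk z hz'⟩)
  rw [dist_eq_norm]
  linarith

instance (σ : ℝ) [Fact (0 < σ)] (n : ℕ) : CompleteSpace (LaplaceSpace σ n) := by
  refine Metric.complete_of_cauchySeq_tendsto fun u hu => ?_
  have hunif : ∀ R ε : ℝ, 0 < ε → ∃ N, ∀ j ≥ N, ∀ k ≥ N, ∀ z : EuclideanSpace ℂ (Fin n),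
      ‖z‖ ≤ R → ‖toFun σ n (u j) z - toFun σ n (u k) z‖ ≤ ε := by
    intro R ε hε
    obtain ⟨C, hC, h⟩ := exists_eval_le σ n R
    obtain ⟨N, hN⟩ := Metric.cauchySeq_iff.1 hu (ε / C) (by positivity)
    refine ⟨N, fun j hj k hk z hz => ?_⟩
    have h1 := h (u j - u k) z hz
    rw [map_sub, Pi.sub_apply] at h1
    have h2 := hN j hj k hk
    rw [dist_eq_norm, lt_div_iff₀ hC] at h2
    linarith
  have hcau (z : EuclideanSpace ℂ (Fin n)) : CauchySeq fun k => toFun σ n (u k) z := by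
    rw [Metric.cauchySeq_iff]
    intro ε hε
    obtain ⟨N, hN⟩ := hunif ‖z‖ (ε / 2) (half_pos hε)
    refine ⟨N, fun j hj k hk => ?_⟩
    rw [dist_eq_norm]
    linarith [hN j hj k hk z le_rfl]
  choose f hf using fun z => cauchySeq_tendsto_of_complete (hcau z)
  have hdiff : Differentiable ℂ f :=
    differentiable_of_limit (fun k => differentiable (u k)) hf hunif
  have hmeas : AEStronglyMeasurable f (laplaceMeasure σ n) :=
    hdiff.continuous.aestronglyMeasurable
  have hfat : ∀ ε : ℝ, 0 < ε → ∃ N, ∀ k ≥ N,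
      eLpNorm (f - toFun σ n (u k)) 2 (laplaceMeasure σ n) ≤ ENNReal.ofReal ε := by
    intro ε hε
    obtain ⟨N, hN⟩ := Metric.cauchySeq_iff.1 hu ε hε
    refine ⟨N, fun k hk => ?_⟩
    refine (Lp.eLpNorm_lim_le_liminf_eLpNorm (f := fun j => toFun σ n (u j) - toFun σ n (u k))
      (fun j => ((memLp (u j)).sub (memLp (u k))).1) _
      (Eventually.of_forall fun z => (hf z).sub_const _)).trans ?_
    refine liminf_le_of_frequently_le' (Eventually.frequently ?_)
    filter_upwards [eventually_ge_atTop N] with j hj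
    rw [← map_sub, ← enorm_eq, ← ofReal_norm, ← dist_eq_norm]
    exact ENNReal.ofReal_le_ofReal (hN j hj k hk).le
  have hmem : MemLp f 2 (laplaceMeasure σ n) := by
    obtain ⟨N, hN⟩ := hfat 1 one_pos
    have h1 : MemLp (f - toFun σ n (u N)) 2 (laplaceMeasure σ n) :=
      ⟨hmeas.sub (memLp (u N)).1, (hN N le_rfl).trans_lt ENNReal.ofReal_lt_top⟩
    simpa using h1.add (memLp (u N))
  let g : LaplaceSpace σ n := ⟨f, hdiff, hmem⟩
  have hg : toFun σ n g = f := rfl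
  refine ⟨g, Metric.tendsto_atTop.2 fun ε hε => ?_⟩
  obtain ⟨N, hN⟩ := hfat (ε / 2) (half_pos hε)
  refine ⟨N, fun k hk => ?_⟩
  have h1 := hN k hk
  rw [← hg, ← map_sub, ← enorm_eq, ← ofReal_norm,
    ENNReal.ofReal_le_ofReal_iff (half_pos hε).le] at h1
  rw [dist_comm, dist_eq_norm]
  linarith

instance (σ : ℝ) [Fact (0 < σ)] (n : ℕ) :
    RKHS ℂ (LaplaceSpace σ n) (EuclideanSpace ℂ (Fin n)) ℂ where
  coeCLM :=
    { toFun σ n with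
      cont := continuous_pi fun z => by
        obtain ⟨C, _, h⟩ := exists_eval_le σ n ‖z‖
        exact (((LinearMap.proj z).comp (toFun σ n)).mkContinuous C fun f => h f z le_rfl).cont }
  coeCLM_injective := toFun_injective σ n

theorem coe_eq_toFun {σ : ℝ} [Fact (0 < σ)] {n : ℕ} (f : LaplaceSpace σ n) :
    (f : EuclideanSpace ℂ (Fin n) → ℂ) = toFun σ n f :=
  rfl

/-- The reproducing kernel at `z`: the element `K_z` of the space with `⟪K_z, f⟫ = f z`. -/
def repKernel (σ : ℝ) [Fact (0 < σ)] {n : ℕ} (z : EuclideanSpace ℂ (Fin n)) : LaplaceSpace σ n :=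
  RKHS.kerFun (LaplaceSpace σ n) z 1

theorem inner_repKernel {σ : ℝ} [Fact (0 < σ)] {n : ℕ} (z : EuclideanSpace ℂ (Fin n))
    (f : LaplaceSpace σ n) : inner ℂ (repKernel σ z) f = f z := by
  simp [repKernel]

end LaplaceSpace

/-- The Koopman operator `f ↦ f ∘ φ`, with domain `{f ∈ H | f ∘ φ ∈ H}`. -/
def koopman (σ : ℝ) {n : ℕ} (φ : EuclideanSpace ℂ (Fin n) → EuclideanSpace ℂ (Fin n)) :
    LaplaceSpace σ n →ₗ.[ℂ] LaplaceSpace σ n where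
  domain := (laplaceSubmodule σ n).comap
    ((LinearMap.funLeft ℂ ℂ φ).comp (LaplaceSpace.toFun σ n))
  toFun :=
    { toFun := fun f => ⟨LaplaceSpace.toFun σ n f.1 ∘ φ, f.2⟩
      map_add' := fun _ _ => rfl
      map_smul' := fun _ _ => rfl }

theorem koopman_apply {σ : ℝ} [Fact (0 < σ)] {n : ℕ}
    {φ : EuclideanSpace ℂ (Fin n) → EuclideanSpace ℂ (Fin n)} (f : (koopman σ φ).domain)
    (z : EuclideanSpace ℂ (Fin n)) : koopman σ φ f z = (f : LaplaceSpace σ n) (φ z) :=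
  rfl

/-- A partially defined operator `T` on `H` is bounded over `H` if it is defined on all of `H` and
`‖T f‖ ≤ C ‖f‖` for some constant `C`. -/
def LinearPMap.IsBoundedOp {H : Type*} [NormedAddCommGroup H] [InnerProductSpace ℂ H]
    (T : H →ₗ.[ℂ] H) : Prop :=
  T.domain = ⊤ ∧ ∃ C : ℝ, ∀ f : T.domain, ‖T f‖ ≤ C * ‖f‖

/-- A bounded operator, as a continuous linear map. -/
def LinearPMap.IsBoundedOp.toCLM {H : Type*} [NormedAddCommGroup H] [InnerProductSpace ℂ H]
    {T : H →ₗ.[ℂ] H} (hT : T.IsBoundedOp) : H →L[ℂ] H :=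
  (T.toFun.comp (LinearMap.id.codRestrict T.domain fun f => by
    rw [hT.1]; trivial)).mkContinuousOfExistsBound
    (by obtain ⟨C, hC⟩ := hT.2; exact ⟨C, fun f => hC _⟩)

theorem koopman_toCLM_apply {σ : ℝ} [Fact (0 < σ)] {n : ℕ}
    {φ : EuclideanSpace ℂ (Fin n) → EuclideanSpace ℂ (Fin n)} (hT : (koopman σ φ).IsBoundedOp)
    (f : LaplaceSpace σ n) (z : EuclideanSpace ℂ (Fin n)) : hT.toCLM f z = f (φ z) :=
  rfl

/-- The essential norm: the distance, in operator norm, to the compact operators. -/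
def essNorm {X Y : Type*} [NormedAddCommGroup X] [NormedSpace ℂ X] [NormedAddCommGroup Y]
    [NormedSpace ℂ Y] (T : X →L[ℂ] Y) : ℝ :=
  sInf {r : ℝ | ∃ S : X →L[ℂ] Y, IsCompactOperator S ∧ r = ‖T - S‖}

/-- `Π_z(φ; σ) = ‖K_φ^* K_z‖² / ‖K_z‖²`, where `K_φ^*` is the adjoint of the bounded Koopman
operator of `φ` and `K_z` is the reproducing kernel at `z`. -/
def koopmanPi {σ : ℝ} [Fact (0 < σ)] {n : ℕ}
    {φ : EuclideanSpace ℂ (Fin n) → EuclideanSpace ℂ (Fin n)} (hK : (koopman σ φ).IsBoundedOp)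
    (z : EuclideanSpace ℂ (Fin n)) : ℝ :=
  ‖ContinuousLinearMap.adjoint hK.toCLM (LaplaceSpace.repKernel σ z)‖ ^ 2 /
    ‖LaplaceSpace.repKernel σ z‖ ^ 2

end

/-!
Because `φ` is affine with linear part of norm less than `1`, both inequalities hold with all
three quantities equal to zero: the Koopman operator is compact, and `Π_z(φ; σ) → 0`.

The reason is the exponential growth of the reproducing kernel. On the one hand
`‖K_z‖² ≤ C exp (‖z‖ / σ)`, by the sub-mean value inequality on a unit ball around `z`
(`LaplaceSpace.exists_norm_sq_repKernel_le`). On the other hand, for each `c < 1`, testing `K_z`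
against `w ↦ exp (c ⟪u, w⟫ / (2σ))` with `u = z / ‖z‖` gives `exp (c ‖z‖ / σ) ≤ D ‖K_z‖²`
(`LaplaceSpace.exists_exp_le_norm_sq_repKernel`). The adjoint of the Koopman operator maps `K_z` to
`K_{φ z}`, and `‖φ z‖ ≤ a ‖z‖ + b` with `a = ‖A‖ < 1`; taking `a < c < 1`, the quotient
`Π_z = ‖K_{φ z}‖² / ‖K_z‖²` decays like `exp (-(c - a) ‖z‖ / σ)`.

The upper bound on the kernel also shows that the Koopman operator is Hilbert–Schmidt: for a
Hilbert basis `e`, Bessel's inequality gives `∑ |eᵢ (φ z)|² ≤ ‖K_{φ z}‖²`, which is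
`O(exp (a ‖z‖ / σ))` and therefore integrable for the weight `exp (-‖z‖ / σ)`. A Hilbert–Schmidt
operator is compact, so the essential norm vanishes.
-/

/-! ### Hilbert–Schmidt operators are compact -/

/-- An operator on a Hilbert space with `∑ ‖T eᵢ‖² < ∞` for some Hilbert basis `e` is compact: it is
the norm limit of its finite rank truncations `∑_{i ∈ s} ⟪eᵢ, ·⟫ T eᵢ`. -/
theorem HilbertBasis.isCompactOperator_of_summable_norm_sq {ι H F : Type*}
    [NormedAddCommGroup H] [InnerProductSpace ℂ H] [NormedAddCommGroup F] [NormedSpace ℂ F]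
    [CompleteSpace F] (b : HilbertBasis ι ℂ H) (T : H →L[ℂ] F)
    (hT : Summable fun i => ‖T (b i)‖ ^ 2) : IsCompactOperator T := by
  classical
  let S : Finset ι → H →L[ℂ] F := fun s => ∑ i ∈ s, (innerSL ℂ (b i)).smulRight (T (b i))
  have hS (s : Finset ι) (f : H) : S s f = ∑ i ∈ s, inner ℂ (b i) f • T (b i) := by
    simp [S]
  have hcompact (s : Finset ι) : IsCompactOperator (S s) := by
    have hrank (i : ι) : IsCompactOperator ((innerSL ℂ (b i)).smulRight (T (b i))) :=
      (isCompactOperator_of_locallyCompactSpace_dom (innerSL ℂ (b i))).clm_comp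
        (ContinuousLinearMap.toSpanSingleton ℂ (T (b i)))
    induction s using Finset.induction_on with
    | empty => exact isCompactOperator_zero
    | insert i s hi ih =>
      simp only [S, Finset.sum_insert hi]
      exact (hrank i).add ih
  have hlim (f : H) : Tendsto (fun t => S t f) atTop (𝓝 (T f)) := by
    have h : HasSum (fun i => T (b.repr f i • b i)) (T f) := (b.hasSum_repr f).mapL T
    simp only [map_smul, b.repr_apply_apply] at h
    simp only [hS]
    exact h
  refine isCompactOperator_of_tendsto (l := atTop) (F := S) ?_ (Eventually.of_forall hcompact)
  rw [Metric.tendsto_nhds]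
  intro ε hε
  obtain ⟨s₀, hs₀⟩ := summable_iff_vanishing_norm.1 hT ((ε / 2) ^ 2) (by positivity)
  filter_upwards [eventually_ge_atTop s₀] with s hs
  rw [dist_comm, dist_eq_norm]
  refine lt_of_le_of_lt (ContinuousLinearMap.opNorm_le_bound _ (half_pos hε).le fun f => ?_)
    (half_lt_self hε)
  refine le_of_tendsto ((hlim f).sub_const (S s f)).norm ?_
  filter_upwards [eventually_ge_atTop s] with t ht
  rw [hS, hS, ← Finset.sum_sdiff ht, add_sub_cancel_right]
  have htail : ∑ i ∈ t \ s, ‖T (b i)‖ ^ 2 ≤ (ε / 2) ^ 2 :=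
    (le_abs_self _).trans
      (hs₀ (t \ s) (Finset.sdiff_disjoint.mono_right hs)).le
  have hbessel : ∑ i ∈ t \ s, ‖inner ℂ (b i) f‖ ^ 2 ≤ ‖f‖ ^ 2 :=
    b.orthonormal.sum_inner_products_le f
  calc ‖∑ i ∈ t \ s, inner ℂ (b i) f • T (b i)‖
      ≤ ∑ i ∈ t \ s, ‖inner ℂ (b i) f‖ * ‖T (b i)‖ :=
        norm_sum_le_of_le _ fun i _ => (norm_smul _ _).le
    _ ≤ ε / 2 * ‖f‖ := by
        refine le_of_sq_le_sq ?_ (by positivity)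
        calc _ ≤ _ := Finset.sum_mul_sq_le_sq_mul_sq _ _ _
          _ ≤ ‖f‖ ^ 2 * (ε / 2) ^ 2 := by gcongr
          _ = _ := by ring

/-- The essential norm of a compact operator is zero. -/
theorem essNorm_eq_zero {X Y : Type*} [NormedAddCommGroup X] [NormedSpace ℂ X]
    [NormedAddCommGroup Y] [NormedSpace ℂ Y] {T : X →L[ℂ] Y} (hT : IsCompactOperator T) :
    essNorm T = 0 := by
  refine le_antisymm (csInf_le ⟨0, ?_⟩ ⟨T, hT, by simp⟩)
    (Real.sInf_nonneg ?_) <;>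
  · rintro _ ⟨S, -, rfl⟩
    exact norm_nonneg _

/-! ### Exponentials of the norm in the Laplace weight -/

/-- `exp (-δ ‖x‖)` is integrable, because it decays faster than every power of `1 + ‖x‖`. -/
theorem integrable_exp_neg_mul_norm {E : Type*} [NormedAddCommGroup E] [NormedSpace ℝ E]
    [FiniteDimensional ℝ E] [MeasurableSpace E] [BorelSpace E] (μ : Measure E)
    [μ.IsAddHaarMeasure] {δ : ℝ} (hδ : 0 < δ) : Integrable (fun x => Real.exp (-(δ * ‖x‖))) μ := by
  set r : ℝ := Module.finrank ℝ E + 1 with hr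
  have h0 := tendsto_rpow_mul_exp_neg_mul_atTop_nhds_zero r δ hδ
  obtain ⟨C, hC⟩ : ∃ C : ℝ, ∀ t : ℝ, 0 ≤ t → (1 + t) ^ r * Real.exp (-(δ * t)) ≤ C := by
    have hcont : ContinuousOn (fun t : ℝ => t ^ r * Real.exp (-δ * t)) (Set.Ici 1) := by
      refine ContinuousOn.mul (fun t ht => ?_) (by fun_prop)
      exact (Real.continuousAt_rpow_const _ _ (.inl (by
        have : (1 : ℝ) ≤ t := ht
        positivity))).continuousWithinAt
    obtain ⟨M, hM⟩ := (h0.eventually (Iio_mem_nhds one_pos)).exists_forall_of_atTop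
    obtain ⟨D, hD⟩ := (isCompact_Icc (a := (1 : ℝ)) (b := M)).bddAbove_image
      (hcont.mono Set.Icc_subset_Ici_self)
    refine ⟨max D 1 * Real.exp δ, fun t ht => ?_⟩
    have h1 : (1 + t) ^ r * Real.exp (-δ * (1 + t)) ≤ max D 1 := by
      rcases le_total M (1 + t) with h | h
      · exact (hM _ h).le.trans (le_max_right _ _)
      · exact (hD ⟨1 + t, ⟨by linarith, h⟩, rfl⟩).trans (le_max_left _ _)
    calc _ = (1 + t) ^ r * Real.exp (-δ * (1 + t)) * Real.exp δ := by
          rw [mul_assoc, ← Real.exp_add]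
          ring_nf
      _ ≤ _ := by gcongr
  refine ((integrable_one_add_norm (μ := μ) (r := r) (by linarith)).const_mul C).mono'
    (by fun_prop) (Eventually.of_forall fun x => ?_)
  rw [Real.norm_of_nonneg (Real.exp_pos _).le, Real.rpow_neg (by positivity), ← div_eq_mul_inv,
    le_div_iff₀ (by positivity), mul_comm]
  exact hC _ (norm_nonneg x)

/-- Integrability for the Laplace weight, expressed on Lebesgue measure. -/
theorem integrable_laplaceMeasure_iff {σ : ℝ} [hσ : Fact (0 < σ)] {n : ℕ}
    {f : EuclideanSpace ℂ (Fin n) → ℝ} :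
    Integrable f (laplaceMeasure σ n) ↔
      Integrable (fun z => ((2 * Real.pi * σ ^ 2) ^ n)⁻¹ * Real.exp (-(‖z‖ / σ)) * f z) volume := by
  rw [laplaceMeasure, integrable_withDensity_iff_integrable_smul'
    (LaplaceSpace.measurable_density σ n) (Eventually.of_forall fun _ => ENNReal.ofReal_lt_top)]
  refine integrable_congr (Eventually.of_forall fun z => ?_)
  simp only [smul_eq_mul]
  rw [ENNReal.toReal_ofReal (LaplaceSpace.density_pos hσ.out z).le]

theorem integrable_exp_mul_norm_laplaceMeasure {σ : ℝ} [hσ : Fact (0 < σ)] (n : ℕ) {c : ℝ}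
    (hc : c < 1) : Integrable (fun z => Real.exp (c * ‖z‖ / σ)) (laplaceMeasure σ n) := by
  rw [integrable_laplaceMeasure_iff]
  have h := (integrable_exp_neg_mul_norm (volume : Measure (EuclideanSpace ℂ (Fin n)))
    (div_pos (sub_pos.2 hc) hσ.out)).const_mul ((2 * Real.pi * σ ^ 2) ^ n)⁻¹
  refine h.congr (Eventually.of_forall fun z => ?_)
  simp only [mul_assoc, ← Real.exp_add]
  ring_nf

/-! ### Growth of the reproducing kernel -/

namespace LaplaceSpace

/-- The sub-mean value inequality over a unit ball, where the weight is at least a multiple of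
`exp (-‖z‖ / σ)`, bounds point evaluations with an explicit rate of growth. -/
theorem exists_sq_eval_le_exp (σ : ℝ) [hσ : Fact (0 < σ)] (n : ℕ) :
    ∃ C : ℝ, 0 < C ∧ ∀ (f : LaplaceSpace σ n) (z : EuclideanSpace ℂ (Fin n)),
      ‖f z‖ ^ 2 ≤ C * Real.exp (‖z‖ / σ) * ‖f‖ ^ 2 := by
  have hσ' := hσ.out
  set v : ℝ := (volume (Metric.ball (0 : EuclideanSpace ℂ (Fin n)) 1)).toReal with hv
  have hvtop : volume (Metric.ball (0 : EuclideanSpace ℂ (Fin n)) 1) ≠ ⊤ :=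
    measure_ball_lt_top.ne
  have hv0 : 0 < v :=
    ENNReal.toReal_pos (Metric.measure_ball_pos volume _ one_pos).ne' hvtop
  refine ⟨(2 * Real.pi * σ ^ 2) ^ n * Real.exp (1 / σ) / v, by positivity, fun f z => ?_⟩
  set m : ℝ := ((2 * Real.pi * σ ^ 2) ^ n)⁻¹ * Real.exp (-((‖z‖ + 1) / σ)) with hm
  have hm0 : 0 < m := by positivity
  have key : ENNReal.ofReal m * (‖toFun σ n f z‖ₑ ^ 2 * ENNReal.ofReal v) ≤ ‖f‖ₑ ^ 2 := by
    rw [hv, ENNReal.ofReal_toReal hvtop, ← lintegral_sq, laplaceMeasure,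
      lintegral_withDensity_eq_lintegral_mul₀ (measurable_density σ n).aemeasurable
        ((differentiable f).continuous.enorm.measurable.pow_const 2).aemeasurable]
    have hb := ball_mean ((differentiable f).pow 2) z
    simp only [Pi.pow_apply, enorm_pow] at hb
    calc _ ≤ ENNReal.ofReal m * ∫⁻ w in Metric.ball z 1, ‖toFun σ n f w‖ₑ ^ 2 := by gcongr
      _ = ∫⁻ w in Metric.ball z 1, ENNReal.ofReal m * ‖toFun σ n f w‖ₑ ^ 2 := by
        rw [lintegral_const_mul]
        exact (differentiable f).continuous.enorm.measurable.pow_const 2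
      _ ≤ ∫⁻ w in Metric.ball z 1, ENNReal.ofReal (((2 * Real.pi * σ ^ 2) ^ n)⁻¹ *
            Real.exp (-(‖w‖ / σ))) * ‖toFun σ n f w‖ₑ ^ 2 := by
        refine setLIntegral_mono' measurableSet_ball fun w hw => ?_
        have hw' : ‖w‖ ≤ ‖z‖ + 1 := by
          rw [mem_ball_iff_norm] at hw
          linarith [norm_sub_norm_le w z]
        rw [hm]
        gcongr
      _ ≤ _ := setLIntegral_le_lintegral _ _
  have key' : m * (‖toFun σ n f z‖ ^ 2 * v) ≤ ‖f‖ ^ 2 := by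
    rw [← ofReal_norm, ← ofReal_norm, ← ENNReal.ofReal_pow (norm_nonneg _),
      ← ENNReal.ofReal_pow (norm_nonneg _), ← ENNReal.ofReal_mul (by positivity),
      ← ENNReal.ofReal_mul hm0.le] at key
    exact (ENNReal.ofReal_le_ofReal_iff (by positivity)).1 key
  have hm' : (2 * Real.pi * σ ^ 2) ^ n * Real.exp (1 / σ) / v * Real.exp (‖z‖ / σ) =
      (m * v)⁻¹ := by
    rw [hm, add_div, Real.exp_neg, Real.exp_add]
    field_simp
  rw [coe_eq_toFun, hm', inv_mul_eq_div, le_div_iff₀ (by positivity)]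
  linarith

theorem exists_norm_sq_repKernel_le (σ : ℝ) [Fact (0 < σ)] (n : ℕ) :
    ∃ C : ℝ, 0 < C ∧ ∀ z : EuclideanSpace ℂ (Fin n),
      ‖repKernel σ z‖ ^ 2 ≤ C * Real.exp (‖z‖ / σ) := by
  obtain ⟨C, hC, h⟩ := exists_sq_eval_le_exp σ n
  refine ⟨C, hC, fun z => ?_⟩
  have h1 := h (repKernel σ z) z
  rw [← inner_repKernel, inner_self_eq_norm_sq_to_K] at h1
  simp only [norm_pow, RCLike.norm_ofReal, abs_norm] at h1
  rcases (sq_nonneg ‖repKernel σ z‖).eq_or_lt with h0 | h0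
  · rw [← h0]
    positivity
  · exact le_of_mul_le_mul_right (by rwa [sq (‖repKernel σ z‖ ^ 2)] at h1) h0

/-- The functions `w ↦ exp (c ⟪u, w⟫ / (2σ))` with `‖u‖ ≤ 1` have uniformly bounded norm when
`c < 1`; the one with `u` in the direction of `z` makes the reproducing kernel at `z` large. -/
theorem exists_exp_le_norm_sq_repKernel (σ : ℝ) [hσ : Fact (0 < σ)] (n : ℕ) {c : ℝ} (hc0 : 0 ≤ c)
    (hc : c < 1) : ∃ D : ℝ, ∀ z : EuclideanSpace ℂ (Fin n),
      Real.exp (c * ‖z‖ / σ) ≤ D * ‖repKernel σ z‖ ^ 2 := by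
  have hσ' := hσ.out
  have hint := integrable_exp_mul_norm_laplaceMeasure (σ := σ) n hc
  refine ⟨∫ w : EuclideanSpace ℂ (Fin n), Real.exp (c * ‖w‖ / σ) ∂(laplaceMeasure σ n),
    fun z => ?_⟩
  -- For `z = 0` this is `u = 0`, which serves as well.
  let u : EuclideanSpace ℂ (Fin n) := ((‖z‖⁻¹ : ℝ) : ℂ) • z
  have hu : ‖u‖ ≤ 1 := by
    rw [norm_smul, Complex.norm_real, norm_inv, norm_norm]
    exact inv_mul_le_one
  have huz : inner ℂ u z = (‖z‖ : ℂ) := by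
    rw [inner_smul_left, Complex.conj_ofReal, inner_self_eq_norm_sq_to_K]
    rcases eq_or_ne ‖z‖ 0 with h | h
    · simp [h]
    · simp only [Complex.coe_algebraMap]
      norm_cast
      field_simp
  let F : EuclideanSpace ℂ (Fin n) → ℂ :=
    fun w => Complex.exp ((c / (2 * σ) : ℝ) * inner ℂ u w)
  have hF : Differentiable ℂ F :=
    (((innerSL ℂ u).differentiable).const_mul _).cexp
  have hFn (w : EuclideanSpace ℂ (Fin n)) :
      ‖F w‖ ^ 2 = Real.exp (c * (inner ℂ u w).re / σ) := by
    rw [Complex.norm_exp, Complex.re_ofReal_mul, ← Real.exp_nat_mul]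
    congr 1
    push_cast
    field_simp
  have hFle (w : EuclideanSpace ℂ (Fin n)) : ‖F w‖ ^ 2 ≤ Real.exp (c * ‖w‖ / σ) := by
    rw [hFn]
    have : (inner ℂ u w).re ≤ ‖w‖ := calc
      (inner ℂ u w).re ≤ ‖u‖ * ‖w‖ := (Complex.re_le_norm _).trans (norm_inner_le_norm u w)
      _ ≤ ‖w‖ := mul_le_of_le_one_left (norm_nonneg w) hu
    gcongr
  have hFint : Integrable (fun w => ‖F w‖ ^ 2) (laplaceMeasure σ n) :=
    hint.mono' (hF.continuous.norm.pow 2).aestronglyMeasurable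
      (Eventually.of_forall fun w => by simpa using hFle w)
  let f : LaplaceSpace σ n :=
    ⟨F, hF, (memLp_two_iff_integrable_sq_norm hF.continuous.aestronglyMeasurable).2 hFint⟩
  have hfz : ‖inner ℂ (repKernel σ z) f‖ ^ 2 = Real.exp (c * ‖z‖ / σ) := by
    rw [inner_repKernel]
    change ‖F z‖ ^ 2 = _
    rw [hFn, huz, Complex.ofReal_re]
  have hf : ‖f‖ ^ 2 ≤ ∫ w : EuclideanSpace ℂ (Fin n), Real.exp (c * ‖w‖ / σ)
      ∂(laplaceMeasure σ n) := by
    rw [norm_sq]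
    exact integral_mono hFint hint hFle
  calc _ = ‖inner ℂ (repKernel σ z) f‖ ^ 2 := hfz.symm
    _ ≤ (‖repKernel σ z‖ * ‖f‖) ^ 2 := by
      gcongr
      exact norm_inner_le_norm _ _
    _ = ‖f‖ ^ 2 * ‖repKernel σ z‖ ^ 2 := by ring
    _ ≤ _ := by gcongr

end LaplaceSpace

/-! ### Koopman operators of contractive growth -/

theorem adjoint_koopman_repKernel {σ : ℝ} [Fact (0 < σ)] {n : ℕ}
    {φ : EuclideanSpace ℂ (Fin n) → EuclideanSpace ℂ (Fin n)} (hK : (koopman σ φ).IsBoundedOp)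
    (z : EuclideanSpace ℂ (Fin n)) :
    ContinuousLinearMap.adjoint hK.toCLM (LaplaceSpace.repKernel σ z) =
      LaplaceSpace.repKernel σ (φ z) := by
  refine ext_inner_right ℂ fun f => ?_
  rw [ContinuousLinearMap.adjoint_inner_left, LaplaceSpace.inner_repKernel,
    LaplaceSpace.inner_repKernel, koopman_toCLM_apply]

/-- If `φ` grows at most like `a ‖z‖` with `a < 1`, then `‖K_{φ z}‖² = O(exp (a ‖z‖ / σ))`, while
`‖K_z‖²` grows at least like `exp (c ‖z‖ / σ)` for some `c > a`. -/
theorem tendsto_koopmanPi_zero {σ : ℝ} [hσ : Fact (0 < σ)] {n : ℕ}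
    {φ : EuclideanSpace ℂ (Fin n) → EuclideanSpace ℂ (Fin n)} (hK : (koopman σ φ).IsBoundedOp)
    {a b : ℝ} (ha0 : 0 ≤ a) (ha1 : a < 1) (hφ : ∀ z, ‖φ z‖ ≤ a * ‖z‖ + b) :
    Tendsto (koopmanPi hK) (comap (fun z => ‖z‖) atTop) (𝓝 0) := by
  have hσ' := hσ.out
  obtain ⟨c, hac, hc1⟩ := exists_between ha1
  obtain ⟨C, hC, hupper⟩ := LaplaceSpace.exists_norm_sq_repKernel_le σ n
  obtain ⟨D, hlower⟩ := LaplaceSpace.exists_exp_le_norm_sq_repKernel σ n (ha0.trans hac.le) hc1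
  have hbound (z : EuclideanSpace ℂ (Fin n)) :
      koopmanPi hK z ≤ C * D * Real.exp (b / σ) * Real.exp (-((c - a) / σ * ‖z‖)) := by
    have h1 : 0 < D * ‖LaplaceSpace.repKernel σ z‖ ^ 2 := (Real.exp_pos _).trans_le (hlower z)
    have h2 : 0 < ‖LaplaceSpace.repKernel σ z‖ ^ 2 :=
      (sq_nonneg _).lt_of_ne fun h => by simp [← h] at h1
    have hD : 0 < D := pos_of_mul_pos_left h1 h2.le
    rw [koopmanPi, adjoint_koopman_repKernel, div_le_iff₀ h2]
    calc _ ≤ C * Real.exp (‖φ z‖ / σ) := hupper _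
      _ ≤ C * Real.exp ((a * ‖z‖ + b) / σ) := by
        gcongr
        exact hφ z
      _ = C * Real.exp (b / σ) * Real.exp (-((c - a) / σ * ‖z‖)) * Real.exp (c * ‖z‖ / σ) := by
        simp only [mul_assoc, ← Real.exp_add]
        ring_nf
      _ ≤ C * Real.exp (b / σ) * Real.exp (-((c - a) / σ * ‖z‖)) *
          (D * ‖LaplaceSpace.repKernel σ z‖ ^ 2) := by
        gcongr
        exact hlower z
      _ = _ := by ring
  have hlim : Tendsto (fun t : ℝ => C * D * Real.exp (b / σ) * Real.exp (-((c - a) / σ * t)))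
      atTop (𝓝 0) := by
    have h := Real.tendsto_exp_neg_atTop_nhds_zero.comp
      (tendsto_id.const_mul_atTop (div_pos (sub_pos.2 hac) hσ'))
    simpa using h.const_mul (C * D * Real.exp (b / σ))
  exact squeeze_zero (fun z => by unfold koopmanPi; positivity) hbound (hlim.comp tendsto_comap)

/-- If `φ` grows at most like `a ‖z‖` with `a < 1`, then the Koopman operator is Hilbert–Schmidt:
by Bessel's inequality `∑ ‖eᵢ ∘ φ‖²` is at most the integral of `‖K_{φ z}‖²`, which is
`O(exp (a ‖z‖ / σ))` and hence integrable for the weight. -/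
theorem isCompactOperator_koopman {σ : ℝ} [hσ : Fact (0 < σ)] {n : ℕ}
    {φ : EuclideanSpace ℂ (Fin n) → EuclideanSpace ℂ (Fin n)} (hK : (koopman σ φ).IsBoundedOp)
    {a b : ℝ} (ha1 : a < 1) (hφ : ∀ z, ‖φ z‖ ≤ a * ‖z‖ + b) :
    IsCompactOperator hK.toCLM := by
  have hσ' := hσ.out
  obtain ⟨C, hC, hupper⟩ := LaplaceSpace.exists_norm_sq_repKernel_le σ n
  obtain ⟨w, e, -⟩ := exists_hilbertBasis ℂ (LaplaceSpace σ n)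
  have hint := (integrable_exp_mul_norm_laplaceMeasure (σ := σ) n ha1).const_mul
    (C * Real.exp (b / σ))
  have hintT (f : LaplaceSpace σ n) :
      Integrable (fun z => ‖LaplaceSpace.toFun σ n (hK.toCLM f) z‖ ^ 2) (laplaceMeasure σ n) :=
    (memLp_two_iff_integrable_sq_norm (LaplaceSpace.memLp _).1).1 (LaplaceSpace.memLp _)
  refine e.isCompactOperator_of_summable_norm_sq _ (summable_of_sum_le
    (c := ∫ z, C * Real.exp (b / σ) * Real.exp (a * ‖z‖ / σ) ∂(laplaceMeasure σ n))
    (fun i => sq_nonneg _) fun s => ?_)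
  simp only [LaplaceSpace.norm_sq]
  rw [← integral_finsetSum _ fun i _ => hintT (e i)]
  refine integral_mono (integrable_finsetSum _ fun i _ => hintT (e i)) hint fun z => ?_
  calc ∑ i ∈ s, ‖LaplaceSpace.toFun σ n (hK.toCLM (e i)) z‖ ^ 2
      = ∑ i ∈ s, ‖inner ℂ (e i) (LaplaceSpace.repKernel σ (φ z))‖ ^ 2 := by
        refine Finset.sum_congr rfl fun i _ => ?_
        rw [← LaplaceSpace.coe_eq_toFun, koopman_toCLM_apply, norm_inner_symm,
          LaplaceSpace.inner_repKernel]
    _ ≤ ‖LaplaceSpace.repKernel σ (φ z)‖ ^ 2 := e.orthonormal.sum_inner_products_le _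
    _ ≤ C * Real.exp (‖φ z‖ / σ) := hupper _
    _ ≤ C * Real.exp ((a * ‖z‖ + b) / σ) := by
        gcongr
        exact hφ z
    _ = C * Real.exp (b / σ) * Real.exp (a * ‖z‖ / σ) := by
        rw [mul_assoc, ← Real.exp_add]
        ring_nf

theorem mainTheorem3 (n : ℕ) (hn : 0 < n) (σ : ℝ) [Fact (0 < σ)]
    (A : Matrix (Fin n) (Fin n) ℂ) (hA : IsUnit A) (hA1 : ‖Matrix.toEuclideanCLM (𝕜 := ℂ) A‖ < 1)
    (B : EuclideanSpace ℂ (Fin n)) (φ : EuclideanSpace ℂ (Fin n) → EuclideanSpace ℂ (Fin n))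
    (hφ : ∀ z, φ z = Matrix.toEuclideanCLM (𝕜 := ℂ) A z + B)
    (hK : (koopman σ φ).IsBoundedOp) :
    ∃ L : ℝ,
      Tendsto (fun z => √(koopmanPi hK z)) (comap (fun z => ‖z‖) atTop) (𝓝 L) ∧
      L ≤ essNorm hK.toCLM ∧
      essNorm hK.toCLM ≤ ‖A⁻¹.det‖ ^ ((n : ℝ) / 2) * L := by
  have hgrowth (z : EuclideanSpace ℂ (Fin n)) :
      ‖φ z‖ ≤ ‖Matrix.toEuclideanCLM (𝕜 := ℂ) A‖ * ‖z‖ + ‖B‖ := by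
    rw [hφ]
    exact (norm_add_le _ _).trans (by gcongr; exact ContinuousLinearMap.le_opNorm _ _)
  have hess := essNorm_eq_zero (isCompactOperator_koopman hK hA1 hgrowth)
  refine ⟨0, ?_, hess.ge, by simp [hess]⟩
  simpa using (tendsto_koopmanPi_zero hK (norm_nonneg _) hA1 hgrowth).sqrt
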